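/- Fix $n\ge 2$, $1\le p\le\infty$, $\epsilon>0$ and $0<\delta<1$, and let $q$ be the Hölder conjugate of $p$ ($\frac1p+\frac1q=1$, with $1$ and $\infty$ conjugate and $n^{1/\infty}=1$). We say that $m$ samples suffice for learning with parameters $(p,n,\epsilon,\delta)$ if there is a (possibly randomized) algorithm which, given $m$ independent samples from any unknown probability distribution $A$ on $\{1,\dots,n\}$, outputs a probability distribution $\hat A$ on $\{1,\dots,n\}$ with $\Pr[\|A-\hat A\|_p\le\epsilon]\ge 1-\delta$. (i) For every $\delta\in(0,1)$ there are $c,\epsilon_0>0$, depending only on $\delta$, such that for all $2\le p\le\infty$, all $n\ge2$ and all $0<\epsilon<\epsilon_0$: if $m$ samples suffice, then $m\ge c\cdot\frac{1}{\epsilon^2}$. (ii) For every $1<p\le2$ and $\delta\in(0,1)$ there are $c,\epsilon_0>0$, depending only on $p$ and $\delta$, such that for all $0<\epsilon<\epsilon_0$ and all $n\ge 2$ with $n\ge\frac1{\epsilon^q}$: if $m$ samples suffice, then $m\ge c\cdot\frac1{\epsilon^q}$. (iii) For $1\le p\le 2$ and $n\le\frac1{\epsilon^q}$ (that is, $n^{1/q}\epsilon\le1$),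 there is no $\gamma>0$ such that, up to a constant factor depending on $\delta$, $O\!\left(\frac{n}{(n^{1/q}\epsilon)^{2-\gamma}}\right)$ samples suffice for all $\delta$: there is no $\gamma>0$ such that for every $\delta\in(0,1)$ there are $C,\epsilon_0>0$ for which, whenever $n\ge2$, $0<\epsilon<\epsilon_0$ and $n^{1/q}\epsilon\le1$, some number $m\le C\frac{n}{(n^{1/q}\epsilon)^{2-\gamma}}$ of samples suffices. Such a bound in fact fails for all $n$ simultaneously: for every $1\le p\le2$ and $\gamma>0$ there is $\delta\in(0,1)$ such that for every $C>0$ there is $\tau\in(0,1]$ such that, for all $n\ge2$ and $\epsilon>0$ with $n^{1/q}\epsilon\le\tau$, no number $m\le C\frac{n}{(n^{1/q}\epsilon)^{2-\gamma}}$ of samples suffices. -/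

import Mathlib

open scoped ENNReal

/-- The probability distributions on the support `{0, …, n-1}`: vectors with nonnegative entries
that sum to one. -/
abbrev Distr (n : ℕ) : Type := stdSimplex ℝ (Fin n)

/-- The `ℓ_p` distance of two distributions, `1 ≤ p ≤ ∞` (for `p = ∞` the maximum of the
coordinatewise differences). -/
noncomputable def lpDist {n : ℕ} (p : ℝ≥0∞) (A B : Distr n) : ℝ :=
  ‖WithLp.toLp p (fun i => A.1 i - B.1 i)‖

/-- A (possibly randomized) learner that draws `m` samples from a distribution on `n` points: for
every sequence of observed samples, the law of the distribution that it outputs. -/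
abbrev Learner (n m : ℕ) : Type :=
  (Fin m → Fin n) → MeasureTheory.ProbabilityMeasure (Distr n)

/-- The probability that the output of `L`, run on `m` i.i.d. samples from `A`, is within `ℓ_p`
distance `ε` of `A`. The sample sequence `x` has probability `∏ j, A (x j)`. -/
noncomputable def successProb {n m : ℕ} (L : Learner n m) (p : ℝ≥0∞) (ε : ℝ) (A : Distr n) : ℝ :=
  ∑ x : Fin m → Fin n, (∏ j, A.1 (x j)) *
    (L x : MeasureTheory.Measure (Distr n)).real {B | lpDist p A B ≤ ε}

/-- `m` samples suffice to learn every distribution on `n` points up to `ℓ_p` distance `ε` with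
failure probability at most `δ`. -/
def CanLearn (p : ℝ≥0∞) (n m : ℕ) (ε δ : ℝ) : Prop :=
  ∃ L : Learner n m, ∀ A : Distr n, 1 - δ ≤ successProb L p ε A

open Finset MeasureTheory

/-! The argument is a minimax bound by change of measure. If a learner succeeds on every member `A
i` of a finite family, Cauchy–Schwarz against a reference law `U` shows that under `U` its output is
near each `A i` with probability at least `(1 - δ) ^ 2 / χ ^ m`. An output is near at most `V`
members, so `card * (1 - δ) ^ 2 ≤ χ ^ m * V` (`CanLearn.card_mul_le`). Both families perturb a
uniform law on `h` pairs of points, with `χ ≤ 1 + η ^ 2` for relative amplitude `η`. Equally spaced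
biases of one pair give `1 / ε ^ 2`. All `2 ^ h` sign patterns with `η = 4 * h ^ (1 / q) * ε` give
`m * η ^ 2 ≳ h` (`CanLearn.mul_log_sub_le`): taking `h` of order `1 / ε ^ q` makes `η` of order 1
and gives (ii), while `h = n / 2` gives `n / (n ^ (1 / q) * ε) ^ 2`, which exceeds any bound with
exponent `2 - γ` once `n ^ (1 / q) * ε` is small. -/

/-- The `ℓ_p` distance of distributions satisfies the triangle inequality. -/
lemma lpDist_triangle_right {n : ℕ} {p : ℝ≥0∞} (hp : 1 ≤ p) (A B C : Distr n) :
    lpDist p A B ≤ lpDist p A C + lpDist p B C := by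
  have : Fact (1 ≤ p) := ⟨hp⟩
  have h := norm_sub_le (WithLp.toLp p (fun i => A.1 i - C.1 i))
    (WithLp.toLp p (fun i => B.1 i - C.1 i))
  rw [← WithLp.toLp_sub] at h
  have e : ((fun i => A.1 i - C.1 i) - fun i => B.1 i - C.1 i) = fun i => A.1 i - B.1 i := by
    ext i; simp
  rw [e] at h
  exact h

lemma lpDist_nonneg {n : ℕ} {p : ℝ≥0∞} (hp : 1 ≤ p) (A B : Distr n) : 0 ≤ lpDist p A B := by
  have : Fact (1 ≤ p) := ⟨hp⟩
  exact norm_nonneg _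

/-- A coordinate difference is at most the `ℓ_p` distance. -/
lemma abs_sub_le_lpDist {n : ℕ} {p : ℝ≥0∞} (hp : 1 ≤ p) (A B : Distr n) (i : Fin n) :
    |A.1 i - B.1 i| ≤ lpDist p A B := by
  have : Fact (1 ≤ p) := ⟨hp⟩
  exact PiLp.norm_apply_le (WithLp.toLp p (fun i => A.1 i - B.1 i)) i

lemma measurableSet_lpDist_le {n : ℕ} {p : ℝ≥0∞} (hp : 1 ≤ p) (A : Distr n) (ε : ℝ) :
    MeasurableSet {B : Distr n | lpDist p A B ≤ ε} := by
  have : Fact (1 ≤ p) := ⟨hp⟩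
  have hc : Continuous fun B : Distr n => lpDist p A B := by
    unfold lpDist
    refine continuous_norm.comp ((PiLp.continuous_toLp p _).comp ?_)
    exact continuous_pi fun i =>
      continuous_const.sub ((continuous_apply i).comp continuous_subtype_val)
  exact (isClosed_le hc continuous_const).measurableSet

/-! ### Change of measure and the information bound. -/

/-- If every point lies in at most `V` of the measurable sets `S i`, their probabilities sum to at
most `V`. -/
lemma sum_measureReal_le_of_card_le {Ω ι : Type*} [MeasurableSpace Ω] (μ : Measure Ω)
    [IsProbabilityMeasure μ] (s : Finset ι) (S : ι → Set Ω) (hS : ∀ i, MeasurableSet (S i))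
    (V : ℝ) (hV : ∀ ω, ∑ i ∈ s, (S i).indicator (fun _ => (1 : ℝ)) ω ≤ V) :
    ∑ i ∈ s, μ.real (S i) ≤ V := by
  have hint : ∀ i ∈ s, Integrable ((S i).indicator fun _ => (1 : ℝ)) μ := fun i _ =>
    (integrable_const 1).indicator (hS i)
  calc ∑ i ∈ s, μ.real (S i) = ∫ ω, ∑ i ∈ s, (S i).indicator (fun _ => (1 : ℝ)) ω ∂μ := by
        rw [integral_finsetSum s hint]
        refine Finset.sum_congr rfl fun i _ => ?_
        rw [integral_indicator_const _ (hS i)]; simp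
    _ ≤ ∫ _, V ∂μ := integral_mono (integrable_finsetSum s hint) (integrable_const V) hV
    _ = V := by simp

lemma sum_prod_sample {n m : ℕ} (f : Fin n → ℝ) :
    ∑ x : Fin m → Fin n, ∏ j, f (x j) = (∑ a, f a) ^ m := by
  rw [← Fin.prod_const, Finset.prod_univ_sum, Fintype.piFinset_univ]

/-- The change of measure bound: an event has probability under `A` at most the geometric mean of
its probability under `U` and of the `χ²` moment. -/
lemma sq_sum_prod_mul_le {n m : ℕ} (A U : Distr n) (g : (Fin m → Fin n) → ℝ)
    (hg0 : ∀ x, 0 ≤ g x) (hg1 : ∀ x, g x ≤ 1) (hac : ∀ a, U.1 a = 0 → A.1 a = 0) {χ : ℝ}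
    (hχ : ∑ a, A.1 a ^ 2 / U.1 a ≤ χ) :
    (∑ x : Fin m → Fin n, (∏ j, A.1 (x j)) * g x) ^ 2 ≤
      χ ^ m * ∑ x : Fin m → Fin n, (∏ j, U.1 (x j)) * g x := by
  have hU : ∀ a, 0 ≤ U.1 a := U.2.1
  have hUx : ∀ x : Fin m → Fin n, 0 ≤ ∏ j, U.1 (x j) := fun x =>
    Finset.prod_nonneg fun j _ => hU _
  have h1 : (∑ x : Fin m → Fin n, (∏ j, A.1 (x j)) * g x) ^ 2 ≤
      (∑ x : Fin m → Fin n, ∏ j, (A.1 (x j) ^ 2 / U.1 (x j))) *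
        ∑ x : Fin m → Fin n, (∏ j, U.1 (x j)) * g x ^ 2 := by
    refine Finset.sum_sq_le_sum_mul_sum_of_sq_le_mul _
      (fun x _ => Finset.prod_nonneg fun j _ => div_nonneg (sq_nonneg _) (hU _))
      (fun x _ => mul_nonneg (hUx x) (sq_nonneg _)) fun x _ => le_of_eq ?_
    rw [← mul_assoc, ← Finset.prod_mul_distrib, mul_pow, ← Finset.prod_pow]
    congr 1
    refine Finset.prod_congr rfl fun j _ => ?_
    -- Division by zero gives `0`, which is the right value because `A` vanishes there too.
    by_cases h : U.1 (x j) = 0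
    · simp [h, hac _ h]
    · field_simp
  rw [sum_prod_sample (fun a => A.1 a ^ 2 / U.1 a)] at h1
  have h0 : 0 ≤ ∑ a, A.1 a ^ 2 / U.1 a :=
    Finset.sum_nonneg fun a _ => div_nonneg (sq_nonneg _) (hU _)
  refine h1.trans (mul_le_mul (pow_le_pow_left₀ h0 hχ m) (Finset.sum_le_sum fun x _ => ?_)
    (Finset.sum_nonneg fun x _ => mul_nonneg (hUx x) (sq_nonneg _)) (pow_nonneg (h0.trans hχ) m))
  refine mul_le_mul_of_nonneg_left ?_ (hUx x)
  nlinarith [hg0 x, hg1 x]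

/-- The information bound for learning a finite family of distributions of which at most `V` are
`ε`-close to any given distribution. -/
lemma CanLearn.card_mul_le {n m : ℕ} {p : ℝ≥0∞} (hp : 1 ≤ p) {ε δ : ℝ} (hδ : δ < 1)
    (hL : CanLearn p n m ε δ) {ι : Type*} (s : Finset ι) (A : ι → Distr n) (U : Distr n)
    (hac : ∀ i ∈ s, ∀ a, U.1 a = 0 → (A i).1 a = 0) {χ : ℝ} (hχ0 : 0 ≤ χ)
    (hχ : ∀ i ∈ s, ∑ a, (A i).1 a ^ 2 / U.1 a ≤ χ) (V : ℝ)
    (hV : ∀ B : Distr n, ((s.filter fun i => lpDist p (A i) B ≤ ε).card : ℝ) ≤ V) :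
    (s.card : ℝ) * (1 - δ) ^ 2 ≤ χ ^ m * V := by
  obtain ⟨L, hL⟩ := hL
  let S : ι → Set (Distr n) := fun i => {B | lpDist p (A i) B ≤ ε}
  let g : ι → (Fin m → Fin n) → ℝ := fun i x => (L x : Measure (Distr n)).real (S i)
  have hUx : ∀ x : Fin m → Fin n, 0 ≤ ∏ j, U.1 (x j) := fun x =>
    Finset.prod_nonneg fun j _ => U.2.1 _
  have hg : ∀ x, ∑ i ∈ s, g i x ≤ V := fun x => by
    refine sum_measureReal_le_of_card_le _ s S (fun i => measurableSet_lpDist_le hp _ _) V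
      fun B => le_trans (le_of_eq ?_) (hV B)
    rw [Finset.card_filter]
    push_cast
    refine Finset.sum_congr rfl fun i _ => ?_
    simp [S, Set.indicator_apply]
  calc (s.card : ℝ) * (1 - δ) ^ 2 = ∑ i ∈ s, (1 - δ) ^ 2 := by simp
    _ ≤ ∑ i ∈ s, χ ^ m * ∑ x : Fin m → Fin n, (∏ j, U.1 (x j)) * g i x := by
        refine Finset.sum_le_sum fun i hi => ?_
        refine (pow_le_pow_left₀ (by linarith) (hL (A i)) 2).trans ?_
        exact sq_sum_prod_mul_le (A i) U (g i) (fun x => measureReal_nonneg)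
          (fun x => measureReal_le_one) (hac i hi) (hχ i hi)
    _ = χ ^ m * ∑ x : Fin m → Fin n, (∏ j, U.1 (x j)) * ∑ i ∈ s, g i x := by
        rw [← Finset.mul_sum, Finset.sum_comm]
        simp_rw [Finset.mul_sum]
    _ ≤ χ ^ m * ∑ x : Fin m → Fin n, (∏ j, U.1 (x j)) * V := by
        refine mul_le_mul_of_nonneg_left (Finset.sum_le_sum fun x _ => ?_) (pow_nonneg hχ0 m)
        exact mul_le_mul_of_nonneg_left (hg x) (hUx x)
    _ = χ ^ m * V := by
        have hU1 : ∑ a, U.1 a = 1 := U.2.2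
        rw [← Finset.sum_mul, sum_prod_sample, hU1]; simp

/-! ### Paired perturbations of a uniform distribution. -/

lemma sum_fin_ite_lt_two_mul {h n : ℕ} (hn : 2 * h ≤ n) (G : ℕ → ℝ) :
    ∑ i : Fin n, (if (i : ℕ) < 2 * h then G i else 0) =
      ∑ j ∈ range h, (G (2 * j) + G (2 * j + 1)) := by
  rw [Fin.sum_univ_eq_sum_range (fun i => if i < 2 * h then G i else 0) n, ← Finset.sum_filter]
  have : (range n).filter (fun i => i < 2 * h) = range (2 * h) := by
    ext i; simp; omega
  rw [this]
  clear this hn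
  induction h with
  | zero => simp
  | succ k ih =>
    rw [Finset.sum_range_succ, ← ih, show 2 * (k + 1) = 2 * k + 1 + 1 by ring,
      Finset.sum_range_succ, Finset.sum_range_succ, add_assoc]

/-- The weights of the uniform distribution on `2 * h` points, where the pair `2 * j`, `2 * j + 1`
is perturbed by the relative amounts `f j` and `-f j`. -/
noncomputable def pairWeight (h : ℕ) (f : ℕ → ℝ) (i : ℕ) : ℝ :=
  (1 + (if i % 2 = 0 then f (i / 2) else - f (i / 2))) / (2 * h)

lemma pairWeight_even (h : ℕ) (f : ℕ → ℝ) (j : ℕ) :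
    pairWeight h f (2 * j) = (1 + f j) / (2 * h) := by
  simp [pairWeight]

lemma pairWeight_odd (h : ℕ) (f : ℕ → ℝ) (j : ℕ) :
    pairWeight h f (2 * j + 1) = (1 - f j) / (2 * h) := by
  have h1 : (2 * j + 1) / 2 = j := by omega
  have h2 : (2 * j + 1) % 2 ≠ 0 := by omega
  rw [pairWeight, if_neg h2, h1, sub_eq_add_neg]

/-- The perturbed uniform distribution with weights `pairWeight h f` on the first `2 * h` of `n`
points. -/
noncomputable def pairDistr {h n : ℕ} (h0 : 0 < h) (hn : 2 * h ≤ n) (f : ℕ → ℝ)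
    (hf : ∀ j, |f j| ≤ 1) : Distr n :=
  ⟨fun i => if (i : ℕ) < 2 * h then pairWeight h f i else 0, by
    constructor
    · intro i
      dsimp only
      split_ifs
      · unfold pairWeight
        have := abs_le.1 (hf (i / 2))
        refine div_nonneg ?_ (by positivity)
        split_ifs <;> linarith
      · exact le_rfl
    · rw [sum_fin_ite_lt_two_mul hn]
      simp_rw [pairWeight_even, pairWeight_odd, ← add_div]
      have : (h : ℝ) ≠ 0 := by positivity
      simp; field_simp; norm_num⟩

lemma pairDistr_apply {h n : ℕ} (h0 : 0 < h) (hn : 2 * h ≤ n) (f : ℕ → ℝ)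
    (hf : ∀ j, |f j| ≤ 1) (i : Fin n) : (pairDistr h0 hn f hf).1 i =
      if (i : ℕ) < 2 * h then pairWeight h f i else 0 := rfl

lemma pairDistr_zero_apply {h n : ℕ} (h0 : 0 < h) (hn : 2 * h ≤ n)
    (hf : ∀ j : ℕ, |(fun _ => (0 : ℝ)) j| ≤ 1) (i : Fin n) : (pairDistr h0 hn _ hf).1 i =
      if (i : ℕ) < 2 * h then 1 / (2 * h : ℝ) else 0 := by
  simp [pairDistr_apply, pairWeight]

lemma pairDistr_absolutelyContinuous {h n : ℕ} (h0 : 0 < h) (hn : 2 * h ≤ n) (f : ℕ → ℝ)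
    (hf : ∀ j, |f j| ≤ 1) (hf0 : ∀ j : ℕ, |(fun _ => (0 : ℝ)) j| ≤ 1) (i : Fin n)
    (hi : (pairDistr h0 hn _ hf0).1 i = 0) : (pairDistr h0 hn f hf).1 i = 0 := by
  rw [pairDistr_zero_apply] at hi
  rw [pairDistr_apply]
  have : (h : ℝ) ≠ 0 := by positivity
  split_ifs at hi ⊢
  · simp [this] at hi
  · rfl

/-- The linear terms of opposite sign cancel within each pair, leaving only `f j ^ 2`. -/
lemma pairDistr_chiSq_le {h n : ℕ} (h0 : 0 < h) (hn : 2 * h ≤ n) (f : ℕ → ℝ)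
    (hf : ∀ j, |f j| ≤ 1) (hf0 : ∀ j : ℕ, |(fun _ => (0 : ℝ)) j| ≤ 1) {η : ℝ}
    (hη : ∀ j, |f j| ≤ η) :
    ∑ i, (pairDistr h0 hn f hf).1 i ^ 2 / (pairDistr h0 hn _ hf0).1 i ≤ 1 + η ^ 2 := by
  have hh : (0 : ℝ) < h := by positivity
  have e : ∀ i : Fin n, (pairDistr h0 hn f hf).1 i ^ 2 / (pairDistr h0 hn _ hf0).1 i =
      if (i : ℕ) < 2 * h then pairWeight h f i ^ 2 * (2 * h) else 0 := fun i => by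
    rw [pairDistr_apply, pairDistr_zero_apply]
    split_ifs
    · rw [div_div_eq_mul_div, div_one]
    · simp
  simp_rw [e]
  rw [sum_fin_ite_lt_two_mul hn (fun i => pairWeight h f i ^ 2 * (2 * h))]
  simp_rw [pairWeight_even, pairWeight_odd]
  calc _ ≤ ∑ j ∈ range h, (1 + η ^ 2) / h := by
        refine Finset.sum_le_sum fun j _ => ?_
        have := sq_le_sq' (by linarith [neg_abs_le (f j), hη j]) ((le_abs_self _).trans (hη j))
        have e : ((1 + f j) / (2 * h)) ^ 2 * (2 * h) + ((1 - f j) / (2 * h)) ^ 2 * (2 * h)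
          = (1 + f j ^ 2) / (h : ℝ) := by field_simp; ring
        rw [e]
        gcongr
    _ = 1 + η ^ 2 := by simp; field_simp

lemma lpDist_pairDistr_rpow {h n : ℕ} (h0 : 0 < h) (hn : 2 * h ≤ n) (f g : ℕ → ℝ)
    (hf : ∀ j, |f j| ≤ 1) (hg : ∀ j, |g j| ≤ 1) {p : ℝ≥0∞} (hp : 0 < p.toReal) :
    lpDist p (pairDistr h0 hn f hf) (pairDistr h0 hn g hg) ^ p.toReal =
      ∑ j ∈ range h, 2 * (|f j - g j| / (2 * h)) ^ p.toReal := by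
  have hh : (0 : ℝ) < h := by positivity
  rw [lpDist, PiLp.norm_eq_sum hp, ← Real.rpow_mul (Finset.sum_nonneg fun i _ => by positivity),
    one_div, inv_mul_cancel₀ hp.ne', Real.rpow_one]
  have e : ∀ i : Fin n, ‖(WithLp.toLp p (fun i => (pairDistr h0 hn f hf).1 i -
      (pairDistr h0 hn g hg).1 i)) i‖ ^ p.toReal =
      if (i : ℕ) < 2 * h then |pairWeight h f i - pairWeight h g i| ^ p.toReal else 0 := fun i => by
    simp only [pairDistr_apply, Real.norm_eq_abs]
    split_ifs
    · rfl
    · simp [Real.zero_rpow hp.ne']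
  simp_rw [e]
  rw [sum_fin_ite_lt_two_mul hn (fun i => |pairWeight h f i - pairWeight h g i| ^ p.toReal)]
  refine Finset.sum_congr rfl fun j _ => ?_
  have e1 : |pairWeight h f (2 * j) - pairWeight h g (2 * j)| = |f j - g j| / (2 * h) := by
    rw [pairWeight_even, pairWeight_even, ← sub_div, abs_div, abs_of_pos (by positivity : (0:ℝ) < 2 * h)]
    congr 2; ring
  have e2 : |pairWeight h f (2 * j + 1) - pairWeight h g (2 * j + 1)|
      = |f j - g j| / (2 * h) := by
    rw [pairWeight_odd, pairWeight_odd, ← sub_div, abs_div,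
      abs_of_pos (by positivity : (0:ℝ) < 2 * h), abs_sub_comm (f j)]
    congr 2; ring
  rw [e1, e2]; ring

/-! ### The family of all sign patterns. -/

/-- The volume of a Hamming ball of relative radius `1 / 4` is at most `(15 / 8) ^ h`. -/
lemma card_hamming_ball_le (h : ℕ) (s₀ : Finset ℕ) (hs₀ : s₀ ⊆ range h) :
    (((range h).powerset.filter fun s => 4 * (symmDiff s s₀).card ≤ h).card : ℝ) ≤
      (15 / 8) ^ h := by
  have h1 : ((range h).powerset.filter fun s => 4 * (symmDiff s s₀).card ≤ h).card ≤
      ((range h).powerset.filter fun t => 4 * t.card ≤ h).card := by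
    refine Finset.card_le_card_of_injOn (fun s => symmDiff s s₀) ?_
      ((symmDiff_left_injective s₀).injOn)
    intro s hs
    simp only [coe_filter, Finset.mem_powerset, Set.mem_ofPred_eq] at hs ⊢
    refine ⟨?_, hs.2⟩
    intro x hx
    rcases Finset.mem_symmDiff.1 hx with h | h
    · exact hs.1 h.1
    · exact hs₀ h.1
  refine (Nat.cast_le.2 h1).trans ?_
  rw [Finset.card_filter]
  push_cast
  -- Chernoff weighting: small sets have weight at least 1 since `(3 / 2) ^ 4 / 4 = 81 / 64`, and
  -- the total weight is `(3 / 2 * (1 + 1 / 4)) ^ h`.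
  calc _ ≤ ∑ t ∈ (range h).powerset, (3 / 2 : ℝ) ^ h * (1 / 4) ^ t.card := by
        refine Finset.sum_le_sum fun t _ => ?_
        split_ifs with ht
        · calc (1 : ℝ) ≤ ((3 / 2) ^ 4 * (1 / 4)) ^ t.card := one_le_pow₀ (by norm_num)
            _ = (3 / 2) ^ (4 * t.card) * (1 / 4) ^ t.card := by rw [mul_pow, pow_mul]
            _ ≤ _ := by gcongr; norm_num
        · positivity
    _ = (15 / 8) ^ h := by
        rw [← Finset.mul_sum]
        have := Finset.sum_pow_mul_eq_add_pow (1 / 4 : ℝ) 1 (range h)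
        simp only [one_pow, mul_one, card_range] at this
        rw [this, ← mul_pow]; norm_num

/-- The sample bound from the family of all sign perturbations of the uniform distribution on
`2 * h` points. -/
lemma CanLearn.mul_log_sub_le {h n m : ℕ} (h0 : 0 < h) (hn : 2 * h ≤ n) {p : ℝ≥0∞} (hp : 1 ≤ p)
    (hp' : p ≠ ∞) {r : ℝ} (hr : p.toReal⁻¹ + r = 1) {ε δ : ℝ} (hε : 0 < ε) (hδ : δ < 1)
    (hη : 4 * (h : ℝ) ^ r * ε ≤ 1) (hL : CanLearn p n m ε δ) :
    h * Real.log (16 / 15) + 2 * Real.log (1 - δ) ≤ m * (4 * (h : ℝ) ^ r * ε) ^ 2 := by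
  have hh : (0 : ℝ) < h := by positivity
  have hP : 1 ≤ p.toReal := by
    rw [← ENNReal.toReal_one]; exact ENNReal.toReal_mono hp' hp
  have hP0 : 0 < p.toReal := by linarith
  -- With this amplitude each differing sign adds `2 * 2 ^ p * (2 * ε) ^ p / h` to the `p`-th power
  -- of the distance, so distance at most `2 * ε` allows at most `h / 4` of them.
  set η := 4 * (h : ℝ) ^ r * ε with hηdef
  have hη0 : 0 < η := by positivity
  let f : Finset ℕ → ℕ → ℝ := fun s j => if j ∈ s then η else -η
  have habs : ∀ s j, |f s j| = η := fun s j => by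
    simp only [f]; split_ifs <;> simp [abs_of_pos hη0]
  have hf : ∀ s j, |f s j| ≤ 1 := fun s j => (habs s j).le.trans hη
  let A : Finset ℕ → Distr n := fun s => pairDistr h0 hn (f s) (hf s)
  have hf0 : ∀ j : ℕ, |(fun _ => (0 : ℝ)) j| ≤ 1 := by simp
  have hclose : ∀ s ⊆ range h, ∀ t ⊆ range h, lpDist p (A s) (A t) ≤ 2 * ε →
      4 * (symmDiff s t).card ≤ h := by
    intro s hs t ht hst
    have h1 := Real.rpow_le_rpow (lpDist_nonneg hp (A s) (A t)) hst hP0.le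
    rw [lpDist_pairDistr_rpow h0 hn _ _ _ _ hP0] at h1
    have hsub : symmDiff s t ⊆ range h := by
      intro x hx
      rcases Finset.mem_symmDiff.1 hx with h | h
      · exact hs h.1
      · exact ht h.1
    have h2 : ((symmDiff s t).card : ℝ) * (2 * (η / h) ^ p.toReal) ≤
        (2 * ε) ^ p.toReal := by
      refine le_trans ?_ h1
      rw [← nsmul_eq_mul, ← Finset.sum_const]
      refine le_trans (le_of_eq ?_) (Finset.sum_le_sum_of_subset_of_nonneg hsub
        fun j _ _ => by positivity)
      refine Finset.sum_congr rfl fun j hj => ?_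
      have : |f s j - f t j| = 2 * η := by
        rcases Finset.mem_symmDiff.1 hj with h | h
        · simp only [f, if_pos h.1, if_neg h.2]
          rw [abs_of_pos (by linarith)]; ring
        · simp only [f, if_pos h.1, if_neg h.2]
          rw [abs_of_neg (by linarith)]; ring
      rw [this, mul_div_mul_left _ _ two_ne_zero]
    have h3 : (η / h) ^ p.toReal = 2 ^ p.toReal * (2 * ε) ^ p.toReal / h := by
      have e : η / h = 2 * (2 * ε) * (h : ℝ) ^ (-p.toReal⁻¹) := by
        rw [show -p.toReal⁻¹ = r - 1 by linarith, Real.rpow_sub_one hh.ne', hηdef]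
        field_simp; ring
      rw [e, Real.mul_rpow (by positivity) (by positivity),
        Real.mul_rpow (by positivity) (by positivity), ← Real.rpow_mul hh.le, neg_mul,
        inv_mul_cancel₀ hP0.ne', Real.rpow_neg_one]
      rfl
    rw [h3] at h2
    have hpos : 0 < (2 * ε) ^ p.toReal := by positivity
    have h4 : (2 : ℝ) ≤ 2 ^ p.toReal := by
      simpa using Real.rpow_le_rpow_of_exponent_le (by norm_num : (1 : ℝ) ≤ 2) hP
    have h5 : ((symmDiff s t).card : ℝ) * (2 * 2 ^ p.toReal) ≤ h := by
      have : ((symmDiff s t).card : ℝ) * (2 * 2 ^ p.toReal) / h * (2 * ε) ^ p.toReal ≤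
          1 * (2 * ε) ^ p.toReal := by
        refine le_trans (le_of_eq ?_) (h2.trans (one_mul _).ge)
        ring
      have := le_of_mul_le_mul_right this hpos
      rwa [div_le_one hh] at this
    have h6 : (4 * (symmDiff s t).card : ℝ) ≤ h := by
      nlinarith [Nat.cast_nonneg (α := ℝ) (symmDiff s t).card]
    exact_mod_cast h6
  have key := hL.card_mul_le hp hδ (range h).powerset A (pairDistr h0 hn _ hf0)
    (fun s _ a => pairDistr_absolutelyContinuous h0 hn (f s) (hf s) hf0 a)
    (by positivity : 0 ≤ 1 + η ^ 2)
    (fun s _ => pairDistr_chiSq_le h0 hn (f s) (hf s) hf0 (fun j => (habs s j).le))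
    ((15 / 8) ^ h) (fun B => by
      -- Members near `B` are within `2 * ε` of any one of them, `s₀`, hence lie in a Hamming ball
      -- around it.
      rcases ((range h).powerset.filter fun s => lpDist p (A s) B ≤ ε).eq_empty_or_nonempty
        with he | ⟨s₀, hs₀⟩
      · rw [he]; simp; positivity
      · rw [Finset.mem_filter, Finset.mem_powerset] at hs₀
        refine le_trans (Nat.cast_le.2 (Finset.card_le_card ?_))
          (card_hamming_ball_le h s₀ hs₀.1)
        intro s hs
        rw [Finset.mem_filter] at hs ⊢
        refine ⟨hs.1, hclose s (Finset.mem_powerset.1 hs.1) s₀ hs₀.1 ?_⟩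
        linarith [lpDist_triangle_right hp (A s) (A s₀) B])
  have h1 : (0 : ℝ) < 1 - δ := by linarith
  have hlog := Real.log_le_log (by rw [card_powerset]; positivity) key
  rw [card_powerset, card_range, Real.log_mul (by positivity) (by positivity),
    Real.log_mul (by positivity) (by positivity), Real.log_pow, Real.log_pow] at hlog
  push_cast at hlog
  rw [Real.log_pow, Real.log_pow] at hlog
  have h7 : Real.log (16 / 15) = Real.log 2 - Real.log (15 / 8) := by
    rw [← Real.log_div (by norm_num) (by norm_num)]; norm_num
  have h8 : (m : ℝ) * Real.log (1 + η ^ 2) ≤ m * η ^ 2 := by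
    refine mul_le_mul_of_nonneg_left ?_ (Nat.cast_nonneg _)
    linarith [Real.log_le_sub_one_of_pos (by positivity : 0 < 1 + η ^ 2)]
  rw [h7]
  linarith

/-! ### Equally spaced biases of one pair. -/

/-- For every confidence level, learning to precision `ε` in `ℓ_p` takes order `1 / ε ^ 2`
samples. -/
lemma exists_inv_sq_le_of_canLearn {δ : ℝ} (hδ : δ < 1) :
    ∃ c : ℝ, 0 < c ∧ ∃ ε₀ : ℝ, 0 < ε₀ ∧ ∀ p : ℝ≥0∞, 1 ≤ p → ∀ n m : ℕ, 2 ≤ n → ∀ ε : ℝ,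
      0 < ε → ε < ε₀ → CanLearn p n m ε δ → c * (1 / ε ^ 2) ≤ (m : ℝ) := by
  have h1 : 0 < 1 - δ := by linarith
  -- Enough hypotheses that `K * (1 - δ) ^ 2 > e`, which forces `m * (6 * K * ε) ^ 2 > 1` for any `δ
  -- < 1`.
  obtain ⟨K, hK⟩ := exists_nat_gt (Real.exp 1 / (1 - δ) ^ 2)
  have hK0 : (0 : ℝ) < K := lt_trans (by positivity) hK
  refine ⟨1 / (36 * K ^ 2), by positivity, 1 / (6 * K), by positivity, ?_⟩
  intro p hp n m hn ε hε hε0 hL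
  have hKε : 6 * K * ε < 1 := by
    rw [lt_div_iff₀ (by positivity)] at hε0; linarith
  -- The first weights are `1 / 2 + 3 * k * ε`; a gap of `3 * ε` exceeds `2 * ε`, so `V = 1`. The
  -- value `0` beyond `K` keeps every weight nonnegative.
  let f : ℕ → ℕ → ℝ := fun k _ => if k < K then 6 * k * ε else 0
  have hfK : ∀ k j, |f k j| ≤ 6 * K * ε := fun k j => by
    simp only [f]
    split_ifs with hk
    · rw [abs_of_nonneg (by positivity)]
      have : (k : ℝ) ≤ K := by exact_mod_cast hk.le
      gcongr
    · rw [abs_zero]; positivity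
  have hf : ∀ k j, |f k j| ≤ 1 := fun k j => (hfK k j).trans hKε.le
  have hn' : 2 * 1 ≤ n := by omega
  let A : ℕ → Distr n := fun k => pairDistr one_pos hn' (f k) (hf k)
  have hf0 : ∀ j : ℕ, |(fun _ => (0 : ℝ)) j| ≤ 1 := by simp
  have hsep : ∀ k < K, ∀ l < K, lpDist p (A k) (A l) ≤ 2 * ε → k = l := by
    intro k hk l hl hkl
    have h2 := (abs_sub_le_lpDist hp (A k) (A l) ⟨0, by omega⟩).trans hkl
    have hA : ∀ k < K, (A k).1 ⟨0, by omega⟩ = 1 / 2 + 3 * k * ε := by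
      intro k hk
      simp only [A, pairDistr_apply, pairWeight, f]
      simp [hk]; ring
    rw [hA k hk, hA l hl, show (1 / 2 + 3 * (k : ℝ) * ε) - (1 / 2 + 3 * l * ε) =
      ((k : ℝ) - l) * (3 * ε) by ring, abs_mul, abs_of_pos (by positivity : 0 < 3 * ε)] at h2
    have h3 : |(k : ℝ) - l| < 1 := by nlinarith [abs_nonneg ((k : ℝ) - l)]
    have h4 : |(k : ℤ) - l| < 1 := by exact_mod_cast h3
    have := Int.abs_lt_one_iff.1 h4
    omega
  have key := hL.card_mul_le hp hδ (range K) A (pairDistr one_pos hn' _ hf0)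
    (fun k _ a => pairDistr_absolutelyContinuous one_pos hn' (f k) (hf k) hf0 a)
    (by positivity : 0 ≤ 1 + (6 * K * ε) ^ 2)
    (fun k _ => pairDistr_chiSq_le one_pos hn' (f k) (hf k) hf0 (hfK k))
    1 (fun B => by
      rw [Nat.cast_le_one, Finset.card_le_one]
      intro k hk l hl
      rw [Finset.mem_filter, Finset.mem_range] at hk hl
      refine hsep k hk.1 l hl.1 ?_
      linarith [lpDist_triangle_right hp (A k) (A l) B])
  rw [card_range, mul_one] at key
  have h5 : Real.exp 1 < Real.exp (m * (6 * K * ε) ^ 2) := by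
    rw [div_lt_iff₀ (by positivity)] at hK
    refine hK.trans_le (key.trans ?_)
    rw [Real.exp_nat_mul]
    refine pow_le_pow_left₀ (by positivity) ?_ m
    linarith [Real.add_one_le_exp ((6 * (K : ℝ) * ε) ^ 2)]
  have h6 := Real.exp_lt_exp.1 h5
  rw [div_mul_div_comm, one_mul, div_le_iff₀ (by positivity)]
  nlinarith

/-! ### The range `1 ≤ p ≤ 2`. -/

lemma toReal_inv_add_of_holderConjugate {p q : ℝ≥0∞} (hpq : p.HolderConjugate q) :
    p.toReal⁻¹ + (q⁻¹).toReal = 1 := by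
  have h := hpq.inv_add_inv_eq_one
  have hp : p⁻¹ ≠ ∞ := ne_top_of_le_ne_top ENNReal.one_ne_top (h ▸ le_self_add)
  have hq : q⁻¹ ≠ ∞ := ne_top_of_le_ne_top ENNReal.one_ne_top (h ▸ le_add_self)
  rw [← ENNReal.toReal_inv, ← ENNReal.toReal_add hp hq, h, ENNReal.toReal_one]

/-- For `1 < p ≤ 2` and every confidence level, learning to precision `ε` in `ℓ_p` on at least
`1 / ε ^ q` points takes order `1 / ε ^ q` samples. -/
lemma exists_inv_rpow_le_of_canLearn {p q : ℝ≥0∞} (hpq : p.HolderConjugate q) (hp1 : 1 < p)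
    (hp2 : p ≤ 2) {δ : ℝ} (hδ0 : 0 < δ) (hδ : δ < 1) :
    ∃ c : ℝ, 0 < c ∧ ∃ ε₀ : ℝ, 0 < ε₀ ∧ ∀ n m : ℕ, ∀ ε : ℝ, 0 < ε → ε < ε₀ →
      1 / ε ^ q.toReal ≤ (n : ℝ) → CanLearn p n m ε δ → c * (1 / ε ^ q.toReal) ≤ (m : ℝ) := by
  have hp' : p ≠ ∞ := ne_top_of_le_ne_top (by norm_num) hp2
  have hsum := toReal_inv_add_of_holderConjugate hpq
  rw [ENNReal.toReal_inv] at hsum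
  have hP : 1 < p.toReal := by
    rw [← ENNReal.toReal_one]; exact (ENNReal.toReal_lt_toReal ENNReal.one_ne_top hp').2 hp1
  set Q := q.toReal with hQ
  have hQi : 0 < Q⁻¹ := by
    have := inv_lt_one_of_one_lt₀ hP
    linarith
  have hQ0 : 0 < Q := inv_pos.1 hQi
  have hQ1 : 1 ≤ Q := by
    rw [← inv_le_one₀ hQ0]
    have : 0 < p.toReal⁻¹ := by positivity
    linarith
  set κ := Real.log (16 / 15) with hκ
  have hκ0 : 0 < κ := Real.log_pos (by norm_num)
  set l := - Real.log (1 - δ) with hl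
  have hl0 : 0 < l := by
    have := Real.log_neg (by linarith : 0 < 1 - δ) (by linarith)
    linarith
  -- The bound `1 / 4` ensures `h ≥ 1`; the other makes `2 * l` at most `κ * x ^ Q / 4`, half of the
  -- guaranteed gain `κ * x ^ Q / 2`.
  refine ⟨κ / (4 * 4 ^ Q), by positivity, min (1 / 4) (κ / (32 * l)), by positivity, ?_⟩
  intro n m ε hε hε0 hn hL
  have hε1 : ε < 1 / 4 := hε0.trans_le (min_le_left _ _)
  have hε2 : ε < κ / (32 * l) := hε0.trans_le (min_le_right _ _)
  set x := 1 / (4 * ε) with hx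
  have hx1 : 1 ≤ x := by rw [hx, le_div_iff₀ (by positivity)]; linarith
  have hxQ : x ≤ x ^ Q := by simpa using Real.rpow_le_rpow_of_exponent_le hx1 hQ1
  have hxe : x ^ Q = 1 / 4 ^ Q * (1 / ε ^ Q) := by
    rw [hx, Real.div_rpow (by norm_num) (by positivity), Real.mul_rpow (by norm_num) hε.le,
      Real.one_rpow]
    field_simp
  -- The largest number of pairs for which the amplitude stays at most 1.
  set h := ⌊x ^ Q⌋₊ with hh
  have hle : (h : ℝ) ≤ x ^ Q := Nat.floor_le (by positivity)
  have hlt : x ^ Q < h + 1 := Nat.lt_floor_add_one _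
  have h0 : 0 < h := Nat.floor_pos.2 (hx1.trans hxQ)
  have h1 : (1 : ℝ) ≤ h := by exact_mod_cast h0
  have hhalf : x ^ Q / 2 ≤ h := by linarith
  have h4 : (4 : ℝ) ≤ 4 ^ Q := by
    simpa using Real.rpow_le_rpow_of_exponent_le (by norm_num : (1 : ℝ) ≤ 4) hQ1
  have hεQ : 0 < 1 / ε ^ Q := by positivity
  have hn2 : 2 * h ≤ n := by
    have e : x ^ Q * 4 ^ Q = 1 / ε ^ Q := by rw [hxe]; field_simp
    have : (2 * h : ℝ) ≤ n := by
      have : 0 < x ^ Q := by positivity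
      nlinarith
    exact_mod_cast this
  have hη : 4 * (h : ℝ) ^ Q⁻¹ * ε ≤ 1 := by
    have : (h : ℝ) ^ Q⁻¹ ≤ x := by
      have := Real.rpow_le_rpow (by positivity) hle hQi.le
      rwa [← Real.rpow_mul (by positivity), mul_inv_cancel₀ hQ0.ne', Real.rpow_one] at this
    rw [hx, le_div_iff₀ (by positivity)] at this
    linarith
  have key := hL.mul_log_sub_le h0 hn2 hp1.le hp' hsum hε hδ hη
  have hm : (m : ℝ) * (4 * (h : ℝ) ^ Q⁻¹ * ε) ^ 2 ≤ m :=
    mul_le_of_le_one_right (Nat.cast_nonneg _) (pow_le_one₀ (by positivity) hη)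
  have hx2 : 8 * l ≤ κ * x := by
    rw [hx, mul_one_div, le_div_iff₀ (by positivity)]
    rw [lt_div_iff₀ (by positivity)] at hε2
    linarith
  have hfin : κ / (4 * 4 ^ Q) * (1 / ε ^ Q) = κ * x ^ Q / 4 := by rw [hxe]; field_simp
  rw [hfin]
  nlinarith

/-- The order `n / (n ^ (1 / q) * ε) ^ 2` of the number of samples is necessary. -/
lemma exists_div_sq_le_of_canLearn :
    ∃ δ : ℝ, 0 < δ ∧ δ < 1 ∧ ∃ c : ℝ, 0 < c ∧ ∀ p q : ℝ≥0∞, p.HolderConjugate q → 1 ≤ p → p ≤ 2 →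
      ∀ n m : ℕ, 2 ≤ n → ∀ ε : ℝ, 0 < ε → (n : ℝ) ^ (q⁻¹).toReal * ε ≤ 1 / 4 →
        CanLearn p n m ε δ → c * (n / ((n : ℝ) ^ (q⁻¹).toReal * ε) ^ 2) ≤ (m : ℝ) := by
  set κ := Real.log (16 / 15) with hκ
  have hκ0 : 0 < κ := Real.log_pos (by norm_num)
  -- This `δ` costs `κ / 2`, at most half of `h * κ` even for `h = 1`. With `h = n / 2 ≥ n / 3` and
  -- `η ≤ 4 * t`, the constant is `κ / (2 * 3 * 16)`.
  refine ⟨1 - Real.exp (-(κ / 4)), ?_, ?_, κ / 96, by positivity, ?_⟩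
  · have := Real.exp_lt_one_iff.2 (by linarith : -(κ / 4) < 0)
    linarith
  · linarith [Real.exp_pos (-(κ / 4))]
  intro p q hpq hp1 hp2 n m hn ε hε ht hL
  have hp' : p ≠ ∞ := ne_top_of_le_ne_top (by norm_num) hp2
  have hsum := toReal_inv_add_of_holderConjugate hpq
  set r := (q⁻¹).toReal with hr
  have hr0 : 0 ≤ r := ENNReal.toReal_nonneg
  have h0 : 0 < n / 2 := by omega
  have hn2 : 2 * (n / 2) ≤ n := by omega
  have hn3 : (n : ℝ) ≤ 3 * (n / 2 : ℕ) := by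
    have : n ≤ 3 * (n / 2) := by omega
    exact_mod_cast this
  have h1 : (1 : ℝ) ≤ (n / 2 : ℕ) := by exact_mod_cast h0
  set t := (n : ℝ) ^ r * ε with htdef
  have hn0 : (0 : ℝ) < n := by positivity
  have ht0 : 0 < t := by positivity
  have hle : 4 * ((n / 2 : ℕ) : ℝ) ^ r * ε ≤ 4 * t := by
    rw [htdef, mul_assoc]
    have : ((n / 2 : ℕ) : ℝ) ≤ n := by exact_mod_cast Nat.div_le_self n 2
    gcongr
  have key := hL.mul_log_sub_le h0 hn2 hp1 hp' hsum hε
    (by linarith [Real.exp_pos (-(κ / 4))]) (hle.trans (by linarith))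
  rw [sub_sub_cancel, Real.log_exp] at key
  have h2 : (m : ℝ) * (4 * ((n / 2 : ℕ) : ℝ) ^ r * ε) ^ 2 ≤ m * (4 * t) ^ 2 := by gcongr
  rw [← mul_div_assoc, div_le_iff₀ (by positivity)]
  nlinarith

/-- No bound of order `n / (n ^ (1 / q) * ε) ^ (2 - γ)` on the number of samples is sufficient. -/
lemma exists_not_canLearn_of_le {γ : ℝ} (hγ : 0 < γ) :
    ∃ δ : ℝ, 0 < δ ∧ δ < 1 ∧ ∀ p q : ℝ≥0∞, p.HolderConjugate q → 1 ≤ p → p ≤ 2 →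
      ∀ C : ℝ, 0 < C → ∃ τ : ℝ, 0 < τ ∧ τ ≤ 1 ∧
        ∀ n m : ℕ, 2 ≤ n → ∀ ε : ℝ, 0 < ε → (n : ℝ) ^ (q⁻¹).toReal * ε ≤ τ →
          (m : ℝ) ≤ C * (n / ((n : ℝ) ^ (q⁻¹).toReal * ε) ^ (2 - γ)) →
            ¬ CanLearn p n m ε δ := by
  obtain ⟨δ, hδ0, hδ1, c, hc, H⟩ := exists_div_sq_le_of_canLearn
  refine ⟨δ, hδ0, hδ1, fun p q hpq hp1 hp2 C hC => ?_⟩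
  -- Below this threshold `C * t ^ γ ≤ c / 2`, so the proposed bound is at most half of the
  -- necessary one.
  refine ⟨min (1 / 4) ((c / (2 * C)) ^ γ⁻¹), by positivity,
    (min_le_left _ _).trans (by norm_num), ?_⟩
  intro n m hn ε hε ht hm hL
  have h := H p q hpq hp1 hp2 n m hn ε hε (ht.trans (min_le_left _ _)) hL
  have hn0 : (0 : ℝ) < n := by positivity
  set t := (n : ℝ) ^ (q⁻¹).toReal * ε with htdef
  have ht0 : 0 < t := by positivity
  have h1 : t ^ γ ≤ c / (2 * C) := by
    have := Real.rpow_le_rpow ht0.le (ht.trans (min_le_right _ _)) hγ.le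
    rwa [← Real.rpow_mul (by positivity), inv_mul_cancel₀ hγ.ne', Real.rpow_one] at this
  have e : (n : ℝ) / t ^ (2 - γ) = n / t ^ 2 * t ^ γ := by
    rw [Real.rpow_sub ht0, Real.rpow_two]
    field_simp
  rw [e] at hm
  rw [le_div_iff₀ (by positivity)] at h1
  have hy : 0 < (n : ℝ) / t ^ 2 := by positivity
  nlinarith

theorem theorem5p4 :
    -- `2 ≤ p ≤ ∞`
    (∀ δ : ℝ, 0 < δ → δ < 1 → ∃ c : ℝ, 0 < c ∧ ∃ ε₀ : ℝ, 0 < ε₀ ∧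
      ∀ p : ℝ≥0∞, 2 ≤ p → ∀ n m : ℕ, 2 ≤ n → ∀ ε : ℝ, 0 < ε → ε < ε₀ →
        CanLearn p n m ε δ → c * (1 / ε ^ 2) ≤ (m : ℝ)) ∧
    -- `1 < p ≤ 2`, `n ≥ 1 / ε ^ q`
    (∀ p q : ℝ≥0∞, p.HolderConjugate q → 1 < p → p ≤ 2 →
      ∀ δ : ℝ, 0 < δ → δ < 1 → ∃ c : ℝ, 0 < c ∧ ∃ ε₀ : ℝ, 0 < ε₀ ∧
      ∀ n m : ℕ, 2 ≤ n → ∀ ε : ℝ, 0 < ε → ε < ε₀ → 1 / ε ^ q.toReal ≤ (n : ℝ) →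
        CanLearn p n m ε δ → c * (1 / ε ^ q.toReal) ≤ (m : ℝ)) ∧
    -- `1 ≤ p ≤ 2`, `n ≤ 1 / ε ^ q`, written `n ^ (1 / q) ≤ 1 / ε` to include `q = ∞`
    (∀ p q : ℝ≥0∞, p.HolderConjugate q → 1 ≤ p → p ≤ 2 →
      ¬ ∃ γ : ℝ, 0 < γ ∧ ∀ δ : ℝ, 0 < δ → δ < 1 → ∃ C : ℝ, 0 < C ∧ ∃ ε₀ : ℝ, 0 < ε₀ ∧
        ∀ n : ℕ, 2 ≤ n → ∀ ε : ℝ, 0 < ε → ε < ε₀ → (n : ℝ) ^ (q⁻¹).toReal ≤ 1 / ε →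
          ∃ m : ℕ, (m : ℝ) ≤ C * (n / ((n : ℝ) ^ (q⁻¹).toReal * ε) ^ (2 - γ)) ∧
            CanLearn p n m ε δ) ∧
    -- such a bound fails for all `n`, as soon as `n ^ (1 / q) * ε` is small
    (∀ p q : ℝ≥0∞, p.HolderConjugate q → 1 ≤ p → p ≤ 2 →
      ∀ γ : ℝ, 0 < γ → ∃ δ : ℝ, 0 < δ ∧ δ < 1 ∧ ∀ C : ℝ, 0 < C → ∃ τ : ℝ, 0 < τ ∧ τ ≤ 1 ∧
        ∀ n m : ℕ, 2 ≤ n → ∀ ε : ℝ, 0 < ε → (n : ℝ) ^ (q⁻¹).toReal * ε ≤ τ →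
          (m : ℝ) ≤ C * (n / ((n : ℝ) ^ (q⁻¹).toReal * ε) ^ (2 - γ)) →
            ¬ CanLearn p n m ε δ) := by
  refine ⟨fun δ _ hδ => ?_, fun p q hpq hp1 hp2 δ hδ0 hδ => ?_, ?_, ?_⟩
  · obtain ⟨c, hc, ε₀, hε₀, H⟩ := exists_inv_sq_le_of_canLearn hδ
    exact ⟨c, hc, ε₀, hε₀, fun p hp => H p (one_le_two.trans hp)⟩
  · obtain ⟨c, hc, ε₀, hε₀, H⟩ := exists_inv_rpow_le_of_canLearn hpq hp1 hp2 hδ0 hδ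
    exact ⟨c, hc, ε₀, hε₀, fun n m _ => H n m⟩
  · rintro p q hpq hp1 hp2 ⟨γ, hγ, H⟩
    obtain ⟨δ, hδ0, hδ1, h⟩ := exists_not_canLearn_of_le hγ
    obtain ⟨C, hC, ε₀, hε₀, H⟩ := H δ hδ0 hδ1
    obtain ⟨τ, hτ0, hτ1, h⟩ := h p q hpq hp1 hp2 C hC
    -- The case `n = 2` with `ε` small already refutes the bound.
    set a := ((2 : ℕ) : ℝ) ^ (q⁻¹).toReal with ha
    have ha0 : 0 < a := by positivity
    have hε : 0 < min (ε₀ / 2) (τ / a) := by positivity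
    have hε1 : min (ε₀ / 2) (τ / a) < ε₀ := (min_le_left _ _).trans_lt (by linarith)
    have hε2 : a * min (ε₀ / 2) (τ / a) ≤ τ := by
      have := min_le_right (ε₀ / 2) (τ / a)
      rw [le_div_iff₀ ha0] at this
      linarith
    obtain ⟨m, hm, hL⟩ := H 2 le_rfl _ hε hε1 (by
      rw [le_div_iff₀ hε]; exact hε2.trans hτ1)
    exact h 2 m le_rfl _ hε hε2 hm hL
  · intro p q hpq hp1 hp2 γ hγ
    obtain ⟨δ, hδ0, hδ1, h⟩ := exists_not_canLearn_of_le hγ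
    exact ⟨δ, hδ0, hδ1, h p q hpq hp1 hp2⟩
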